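/- Setting. Let $\mathbb X\subseteq\mathbb R^m$, $\mathbb Y\subseteq\mathbb R$ and $\Xi=\mathbb X\times\mathbb Y$, with the metric $d((x,y),(x',y'))=\|x-x'\|+\frac{\gamma}{2}|y-y'|$, where $\|\cdot\|$ is an arbitrary norm on $\mathbb R^m$ and $\gamma>0$; suppose $(\Xi,d)$ is complete. Let $p\ge 1$, $\sigma>0$, $n\ge 1$ and $\xi_1,\dots,\xi_n\in\Xi$. For a probability vector $w=(w_1,\dots,w_n)$ put $\mathbb P_w=\sum_{i=1}^n w_i\delta_{\xi_i}$, and let $\mathbb P_n=\frac1n\sum_{i=1}^n\delta_{\xi_i}$. Let $\Theta\subseteq\mathbb R^k$ lie in a closed Euclidean ball $B$ of positive radius, and let $\ell(\theta,\xi)\ge 0$ be a loss function such that: * for some $L>0$, $|\ell(\theta_1,\xi)-\ell(\theta_2,\xi)|\le L\|\theta_1-\theta_2\|_2$ for all $\theta_1,\theta_2\in B$ and $\xi\in\Xi$; * $\ell(\theta,\cdot)$ is continuous on $\Xi$ for every $\theta\in\Theta$; * there are a positive continuous function $C$ on $\Theta$ and a point $\xi_0\in\Xi$ with $\ell(\theta,\xi)\le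 C(\theta)\,(1+d(\xi,\xi_0)^p)$ for all $\theta\in\Theta$ and $\xi\in\Xi$. For a probability measure $\mathbb P$ on $\Xi$, let $$R^{\mathbb P}_{\sigma,p}(\theta)=\sup\{\mathbb E^{\mathbb Q}[\ell(\theta,\xi)] : \mathbb Q \text{ a Borel probability measure on }\Xi,\ W_p(\mathbb P,\mathbb Q)\le\sigma\},$$ where $W_p$ is the $p$-th order Wasserstein distance for $d$. The WDRO problem is to minimize $R^{\mathbb P_n}_{\sigma,p}(\theta)$ over $\theta\in\Theta$. For $\lambda\ge0$ let $h_i(\theta,\lambda)=\sup_{\zeta\in\Xi}\{\ell(\theta,\zeta)-\lambda d(\zeta,\xi_i)^p\}\in[0,\infty]$, and let $$\kappa(\theta)=\limsup_{d(\xi,\xi_0)\to\infty}\frac{\ell(\theta,\xi)-\ell(\theta,\xi_0)}{d(\xi,\xi_0)^p},\qquad \tau(\theta)=C(\theta)\Bigl(2^{p-1}+\frac{1+2^{p-1}\rho^p}{\sigma^p}\Bigr),\qquad \rho=\max_{i} d(\xi_i,\xi_0)$$ (if $\Xi$ is bounded, $\kappa(\theta)$ is replaced by $0$). Given $\epsilon\in(0,1)$,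 a *dual $\epsilon$-coreset* is a vector $w=(w_1,\dots,w_n)$ with $w_i\ge0$ and $\sum_i w_i=1$ such that, for all $\theta\in\Theta$ and all $\lambda\in[\kappa(\theta),\tau(\theta)]$, $$(1-\epsilon)\,\frac1n\sum_{i=1}^n h_i(\theta,\lambda)\ \le\ \sum_{i=1}^n w_i h_i(\theta,\lambda)\ \le\ (1+\epsilon)\,\frac1n\sum_{i=1}^n h_i(\theta,\lambda),$$ with the convention $0\cdot\infty=0$. For $\beta\ge1$, a point $\theta_0\in\Theta$ is a *$\beta$-approximate minimizer* of $F:\Theta\to[0,\infty]$ if $F(\theta_0)\le\beta\inf_{\theta\in\Theta}F(\theta)$. Statement. Let $\epsilon\in(0,1)$, $\alpha\ge1$, and let $w$ be a dual $\epsilon$-coreset. If $\theta_0\in\Theta$ is an $\alpha$-approximate minimizer over $\Theta$ of the coreset objective $\theta\mapsto R^{\mathbb P_w}_{\sigma,p}(\theta)$, then $\theta_0$ is an $\alpha\cdot\frac{1+\epsilon}{1-\epsilon}$-approximate minimizer over $\Theta$ of the original WDRO objective $\theta\mapsto R^{\mathbb P_n}_{\sigma,p}(\theta)$. -/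

import Mathlib

open scoped ENNReal

noncomputable section

namespace WDRO

/-- The input-output space `Ξ = 𝕏 × 𝕐`, for a set `𝕏` of features in a finite-dimensional real
normed space (that is, `ℝ^m` with an arbitrary norm) and a set `𝕐` of real labels. It carries the
subspace topology and the Borel σ-algebra of `E × ℝ`. -/
abbrev DataSpace {E : Type*} (X : Set E) (Y : Set ℝ) : Type _ := ↥X × ↥Y

variable {E : Type*} [NormedAddCommGroup E] {X : Set E} {Y : Set ℝ}

/-- The feature-label metric `d(ξ, ξ') = ‖x - x'‖ + (γ / 2) |y - y'|`. -/
def fdist (γ : ℝ) (a b : DataSpace X Y) : ℝ :=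
  ‖(a.1 : E) - (b.1 : E)‖ + γ / 2 * |(a.2 : ℝ) - (b.2 : ℝ)|

section Primal

variable [MeasurableSpace E]

/-- Couplings of `P` and `Q`: measures on `Ξ × Ξ` with marginals `P` and `Q`. -/
def couplings (P Q : MeasureTheory.Measure (DataSpace X Y)) :
    Set (MeasureTheory.Measure (DataSpace X Y × DataSpace X Y)) :=
  {π | π.map Prod.fst = P ∧ π.map Prod.snd = Q}

/-- The `p`-th order Wasserstein distance with respect to `fdist γ`, with values in `[0, ∞]`. -/
def wasserstein (γ p : ℝ) (P Q : MeasureTheory.Measure (DataSpace X Y)) : ℝ≥0∞ :=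
  (⨅ π ∈ couplings P Q, ∫⁻ z, ENNReal.ofReal (fdist γ z.1 z.2 ^ p) ∂π) ^ (1 / p)

/-- The Wasserstein ball: all Borel probability distributions on `Ξ` at distance at most `σ`. -/
def wassersteinBall (γ p σ : ℝ) (P : MeasureTheory.Measure (DataSpace X Y)) :
    Set (MeasureTheory.Measure (DataSpace X Y)) :=
  {Q | MeasureTheory.IsProbabilityMeasure Q ∧ wasserstein γ p P Q ≤ ENNReal.ofReal σ}

/-- The worst-case risk `sup_Q E^Q[f]` over the Wasserstein ball around `P`, for a nonnegative
loss `f = ℓ(θ, ·)`. -/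
def worstCaseRisk (γ p σ : ℝ) (P : MeasureTheory.Measure (DataSpace X Y))
    (f : DataSpace X Y → ℝ) : ℝ≥0∞ :=
  ⨆ Q ∈ wassersteinBall γ p σ P, ∫⁻ ζ, ENNReal.ofReal (f ζ) ∂Q

/-- The weighted empirical distribution `∑ i, w i • δ_{ξ i}`. -/
def weightedEmpirical {n : ℕ} (ξ : Fin n → DataSpace X Y) (w : Fin n → ℝ) :
    MeasureTheory.Measure (DataSpace X Y) :=
  ∑ i, ENNReal.ofReal (w i) • MeasureTheory.Measure.dirac (ξ i)

end Primal

/-- The uniform mass vector `(1/n, …, 1/n)`. -/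
def uniformWeights (n : ℕ) : Fin n → ℝ := fun _ => 1 / (n : ℝ)

/-- `h(θ, t, ξ) = sup_ζ (ℓ(θ, ζ) - t d(ζ, ξ)^p)` as an extended real, where `f = ℓ(θ, ·)`. -/
def moreau (γ p : ℝ) (f : DataSpace X Y → ℝ) (t : ℝ) (ξ : DataSpace X Y) : EReal :=
  ⨆ ζ : DataSpace X Y, ((f ζ - t * fdist γ ζ ξ ^ p : ℝ) : EReal)

/-- `∑ i, w i * h(θ, t, ξ i)`, the expectation of `h(θ, t, ·)` under the weighted empirical
distribution with weights `w`, where `f = ℓ(θ, ·)`. -/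
def dualSum (γ p : ℝ) {n : ℕ} (ξ : Fin n → DataSpace X Y) (w : Fin n → ℝ)
    (f : DataSpace X Y → ℝ) (t : ℝ) : EReal :=
  ∑ i, (w i : EReal) * moreau γ p f t (ξ i)

/-- The asymptotic growth rate
`κ = limsup_{d(ζ, ξ₀) → ∞} (f ζ - f ξ₀) / d(ζ, ξ₀)^p`, as an extended real
(it is `-∞` if `Ξ` is bounded). -/
def growthRate (γ p : ℝ) (f : DataSpace X Y → ℝ) (ξ₀ : DataSpace X Y) : EReal :=
  Filter.limsup (fun ζ => (((f ζ - f ξ₀) / fdist γ ζ ξ₀ ^ p : ℝ) : EReal))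
    (Filter.comap (fun ζ => fdist γ ζ ξ₀) Filter.atTop)

/-- `ρ = max_i d(ξ i, ξ₀)`. -/
def dataRadius (γ : ℝ) {n : ℕ} (ξ : Fin n → DataSpace X Y) (ξ₀ : DataSpace X Y) : ℝ :=
  ⨆ i, fdist γ (ξ i) ξ₀

/-- `τ = c (2^(p-1) + (1 + 2^(p-1) ρ^p) / σ^p)`, where `c = C(θ)`. -/
def multiplierBound (γ p σ : ℝ) {n : ℕ} (ξ : Fin n → DataSpace X Y) (ξ₀ : DataSpace X Y)
    (c : ℝ) : ℝ :=
  c * ((2 : ℝ) ^ (p - 1) + (1 + (2 : ℝ) ^ (p - 1) * dataRadius γ ξ ξ₀ ^ p) / σ ^ p)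

/-- The query region `[κ(θ), τ(θ)]` of dual multipliers. Multipliers are nonnegative, which
matters only if `Ξ` is bounded: then `κ(θ) = -∞` and the region is `[0, τ(θ)]`. -/
def queryRegion (γ p σ : ℝ) {n : ℕ} (ξ : Fin n → DataSpace X Y) (ξ₀ : DataSpace X Y)
    (f : DataSpace X Y → ℝ) (c : ℝ) : Set ℝ :=
  {t | 0 ≤ t ∧ growthRate γ p f ξ₀ ≤ (t : EReal) ∧ t ≤ multiplierBound γ p σ ξ ξ₀ c}

/-- `w` is a dual `ε`-coreset: a nonnegative mass vector of total mass one such that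
`∑ i, w i * h_i(θ, t)` is within `(1 ± ε) (1/n) ∑ i, h_i(θ, t)` for all `θ ∈ Θ` and all `t` in
the query region `[κ(θ), τ(θ)]`. -/
structure IsDualCoreset {V : Type*} (γ p σ : ℝ) (Θ : Set V) (ℓ : V → DataSpace X Y → ℝ)
    {n : ℕ} (ξ : Fin n → DataSpace X Y) (ξ₀ : DataSpace X Y) (C : V → ℝ) (ε : ℝ)
    (w : Fin n → ℝ) : Prop where
  nonneg : ∀ i, 0 ≤ w i
  sum_eq_one : ∑ i, w i = 1
  lower : ∀ θ ∈ Θ, ∀ t ∈ queryRegion γ p σ ξ ξ₀ (ℓ θ) (C θ),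
    ((1 - ε : ℝ) : EReal) * dualSum γ p ξ (uniformWeights n) (ℓ θ) t ≤ dualSum γ p ξ w (ℓ θ) t
  upper : ∀ θ ∈ Θ, ∀ t ∈ queryRegion γ p σ ξ ξ₀ (ℓ θ) (C θ),
    dualSum γ p ξ w (ℓ θ) t ≤ ((1 + ε : ℝ) : EReal) * dualSum γ p ξ (uniformWeights n) (ℓ θ) t

/-- `θ₀` is an `α`-approximate minimizer of `F` over `Θ`. -/
def IsApproxMinimizer {V : Type*} (F : V → ℝ≥0∞) (Θ : Set V) (α : ℝ) (θ₀ : V) : Prop :=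
  θ₀ ∈ Θ ∧ F θ₀ ≤ ENNReal.ofReal α * ⨅ θ ∈ Θ, F θ

end WDRO

end

noncomputable section

namespace WDRO

open MeasureTheory Filter Topology

variable {E : Type*} [NormedAddCommGroup E] {X : Set E} {Y : Set ℝ}

/-! The worst-case risk around a weighted empirical measure is the minimum over multipliers t of t *
σ ^ p plus the weighted sum of the h_i(θ, t), and the minimum is attained inside the query region.
Weak duality (`worstCaseRisk_le`) bounds the risk for every t ≥ 0; strong duality
(`exists_multiplier`) gives an optimal t in the region. Take t optimal for one weight vector and use
it in weak duality for the other. The coreset inequality at t compares the dual sums, and the common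
term t * σ ^ p is nonnegative, so 1 - ε ≤ 1 ≤ 1 + ε takes care of it (`mul_worstCaseRisk_le`). The
two risks thus agree up to factors 1 ± ε, uniformly in θ, and approximate minimizers transfer.
Strong duality comes from a supporting line in the plane of (transport cost, expected loss): mixing
two transports of the samples keeps the second marginal admissible, which supplies the required
concavity. -/

lemma fdist_nonneg {γ : ℝ} (hγ : 0 < γ) (a b : DataSpace X Y) : 0 ≤ fdist γ a b := by
  unfold fdist; positivity

lemma fdist_self (γ : ℝ) (a : DataSpace X Y) : fdist γ a a = 0 := by simp [fdist]

lemma fdist_comm (γ : ℝ) (a b : DataSpace X Y) : fdist γ a b = fdist γ b a := by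
  simp only [fdist, norm_sub_rev, abs_sub_comm]

lemma fdist_triangle {γ : ℝ} (hγ : 0 < γ) (a b c : DataSpace X Y) :
    fdist γ a c ≤ fdist γ a b + fdist γ b c := by
  unfold fdist
  have h₁ := norm_sub_le_norm_sub_add_norm_sub (a.1 : E) (b.1 : E) (c.1 : E)
  have h₂ := mul_le_mul_of_nonneg_left (abs_sub_le (a.2 : ℝ) (b.2 : ℝ) (c.2 : ℝ))
    (by positivity : 0 ≤ γ / 2)
  linarith

lemma continuous_fdist (γ : ℝ) :
    Continuous fun z : DataSpace X Y × DataSpace X Y => fdist γ z.1 z.2 := by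
  unfold fdist; fun_prop

lemma fdist_self_rpow (γ : ℝ) {p : ℝ} (hp : 1 ≤ p) (a : DataSpace X Y) :
    fdist γ a a ^ p = 0 := by
  rw [fdist_self, Real.zero_rpow (by linarith)]

lemma add_rpow_le {p a b : ℝ} (hp : 1 ≤ p) (ha : 0 ≤ a) (hb : 0 ≤ b) :
    (a + b) ^ p ≤ 2 ^ (p - 1) * (a ^ p + b ^ p) := by
  have := NNReal.rpow_add_le_mul_rpow_add_rpow ⟨a, ha⟩ ⟨b, hb⟩ hp
  exact_mod_cast this

lemma fdist_le_dataRadius {γ : ℝ} {n : ℕ} (ξ : Fin n → DataSpace X Y) (ξ₀ : DataSpace X Y)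
    (i : Fin n) : fdist γ (ξ i) ξ₀ ≤ dataRadius γ ξ ξ₀ :=
  le_ciSup (f := fun i => fdist γ (ξ i) ξ₀) (Set.finite_range _).bddAbove i

/-! ### The dual objective with values in [0, ∞]. -/

/-- The function `moreau` with values in `[0, ∞]`. -/
def eMoreau (γ p : ℝ) (f : DataSpace X Y → ℝ) (t : ℝ) (ξ : DataSpace X Y) : ℝ≥0∞ :=
  ⨆ ζ : DataSpace X Y, ENNReal.ofReal (f ζ - t * fdist γ ζ ξ ^ p)

/-- The function `dualSum` with values in `[0, ∞]`. -/
def eDualSum (γ p : ℝ) {n : ℕ} (ξ : Fin n → DataSpace X Y) (w : Fin n → ℝ)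
    (f : DataSpace X Y → ℝ) (t : ℝ) : ℝ≥0∞ :=
  ∑ i, ENNReal.ofReal (w i) * eMoreau γ p f t (ξ i)

/-- Truncating each term at 0 does not change the supremum, because ζ = ξ already contributes f ξ ≥
0. -/
lemma coe_eMoreau {γ p : ℝ} (hp : 1 ≤ p) {f : DataSpace X Y → ℝ} (hf : ∀ ζ, 0 ≤ f ζ) (t : ℝ)
    (ξ : DataSpace X Y) : (eMoreau γ p f t ξ : EReal) = moreau γ p f t ξ := by
  have h0 : 0 ≤ moreau γ p f t ξ := by
    refine le_trans ?_ (le_iSup _ ξ)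
    rw [fdist_self_rpow γ hp]
    simpa using hf ξ
  apply le_antisymm
  · rw [← EReal.coe_toENNReal h0, EReal.coe_ennreal_le_coe_ennreal_iff]
    refine iSup_le fun ζ => ?_
    rw [← EReal.coe_ennreal_le_coe_ennreal_iff, EReal.coe_toENNReal h0, EReal.coe_ennreal_ofReal]
    rcases max_choice (f ζ - t * fdist γ ζ ξ ^ p) 0 with h | h <;> rw [h]
    · exact le_iSup (fun ζ => ((f ζ - t * fdist γ ζ ξ ^ p : ℝ) : EReal)) ζ
    · exact h0
  · refine iSup_le fun ζ => ?_
    refine le_trans ?_ (EReal.coe_ennreal_le_coe_ennreal_iff.2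
      (le_iSup (fun ζ => ENNReal.ofReal (f ζ - t * fdist γ ζ ξ ^ p)) ζ))
    rw [EReal.coe_ennreal_ofReal]
    exact_mod_cast le_max_left _ _

lemma coe_eDualSum {γ p : ℝ} (hp : 1 ≤ p) {f : DataSpace X Y → ℝ} (hf : ∀ ζ, 0 ≤ f ζ) (t : ℝ)
    {n : ℕ} (ξ : Fin n → DataSpace X Y) {w : Fin n → ℝ} (hw : ∀ i, 0 ≤ w i) :
    (eDualSum γ p ξ w f t : EReal) = dualSum γ p ξ w f t := by
  unfold eDualSum dualSum
  have key : ∀ s : Finset (Fin n),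
      ((∑ i ∈ s, ENNReal.ofReal (w i) * eMoreau γ p f t (ξ i) : ℝ≥0∞) : EReal)
        = ∑ i ∈ s, (w i : EReal) * moreau γ p f t (ξ i) := by
    intro s
    induction s using Finset.induction_on with
    | empty => simp
    | insert a s ha ih =>
      rw [Finset.sum_insert ha, Finset.sum_insert ha, EReal.coe_ennreal_add, ih,
        EReal.coe_ennreal_mul, coe_eMoreau hp hf, EReal.coe_ennreal_ofReal, max_eq_left (hw a)]
  exact key _

/-! ### Supporting lines and the growth rate. -/

/-- A family of points `(c a, g a)` of the plane such that every convex combination of two of them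
with abscissa at most `S` has ordinate at most `R` lies below a line of nonnegative slope through
`(S, R)`. -/
lemma exists_supporting_slope {ι : Type*} {c g : ι → ℝ} {S R : ℝ} (a₀ : ι) (ha₀ : c a₀ < S)
    (h : ∀ a b, ∀ t : ℝ, 0 ≤ t → t ≤ 1 → (1 - t) * c a + t * c b ≤ S →
      (1 - t) * g a + t * g b ≤ R) :
    ∃ t : ℝ, 0 ≤ t ∧ ∀ a, g a ≤ R + t * (c a - S) := by
  have h0 : ∀ a, c a ≤ S → g a ≤ R := fun a ha => by
    simpa using h a a 0 le_rfl zero_le_one (by simpa using ha)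
  let A := {a // c a < S}
  have : Nonempty A := ⟨⟨a₀, ha₀⟩⟩
  let q : A → ℝ := fun a => (R - g a) / (S - c a)
  have hq : ∀ a, 0 ≤ q a := fun a =>
    div_nonneg (sub_nonneg.2 (h0 _ a.2.le)) (sub_pos.2 a.2).le
  have hbdd : BddBelow (Set.range q) := ⟨0, by rintro _ ⟨a, rfl⟩; exact hq a⟩
  -- The slope is the infimum of the chord slopes from points left of S to (S, R), the largest slope
  -- compatible with all of them.
  refine ⟨⨅ a, q a, le_ciInf hq, fun a => ?_⟩
  rcases lt_trichotomy (c a) S with ha | ha | ha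
  · have h1 : (⨅ a, q a) ≤ (R - g a) / (S - c a) := ciInf_le hbdd ⟨a, ha⟩
    rw [le_div_iff₀ (sub_pos.2 ha)] at h1
    linarith
  · simpa [ha] using h0 a ha.le
  · have h1 : (g a - R) / (c a - S) ≤ ⨅ a, q a := by
      refine le_ciInf fun b => ?_
      have hb : c b < S := b.2
      have hab : 0 < c a - c b := by linarith
      -- This weight puts the convex combination of b and a exactly at abscissa S.
      have := h b a ((S - c b) / (c a - c b)) (div_nonneg (by linarith) hab.le)
        ((div_le_one hab).2 (by linarith)) (le_of_eq (by field_simp; ring))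
      have e : (1 - (S - c b) / (c a - c b)) * g b + (S - c b) / (c a - c b) * g a
          = ((c a - S) * g b + (S - c b) * g a) / (c a - c b) := by field_simp; ring
      rw [e, div_le_iff₀ hab] at this
      rw [div_le_div_iff₀ (sub_pos.2 ha) (sub_pos.2 hb)]
      linarith
    rw [div_le_iff₀ (sub_pos.2 ha)] at h1
    linarith

/-- Finiteness of h at a single centre forces t ≥ κ: with x = d(ζ, ξ₀), the triangle inequality
gives f ζ ≤ M + t (x + D)^p, and dividing by x^p leaves t in the limit. -/
lemma growthRate_le {γ p : ℝ} (hγ : 0 < γ) (hp : 1 ≤ p) {f : DataSpace X Y → ℝ}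
    (ξ₀ ξ : DataSpace X Y) (hf₀ : 0 ≤ f ξ₀) {t M : ℝ} (ht : 0 ≤ t)
    (h : ∀ ζ, f ζ - t * fdist γ ζ ξ ^ p ≤ M) : growthRate γ p f ξ₀ ≤ (t : EReal) := by
  set D := fdist γ ξ₀ ξ
  have hD : 0 ≤ D := fdist_nonneg hγ _ _
  have lim : Tendsto (fun x : ℝ => M / x ^ p + t * (1 + D / x) ^ p) atTop (𝓝 t) := by
    have h1 : Tendsto (fun x : ℝ => M / x ^ p) atTop (𝓝 0) :=
      tendsto_const_nhds.div_atTop (tendsto_rpow_atTop (by linarith))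
    have h2 : Tendsto (fun x : ℝ => (1 + D / x) ^ p) atTop (𝓝 ((1 + 0) ^ p)) :=
      ((tendsto_const_nhds (x := (1 : ℝ))).add
        (tendsto_const_nhds.div_atTop tendsto_id)).rpow_const (Or.inr (by linarith))
    simpa using h1.add (h2.const_mul t)
  refine le_of_forall_gt_imp_ge_of_dense fun b hb => ?_
  refine limsup_le_of_le (by isBoundedDefault) ?_
  have lim' := (continuous_coe_real_ereal.tendsto t).comp lim
  have ev := ((lim'.eventually (gt_mem_nhds hb)).and (eventually_gt_atTop 0)).comap
    (fun ζ : DataSpace X Y => fdist γ ζ ξ₀)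
  filter_upwards [ev] with ζ hζ
  refine le_trans ?_ hζ.1.le
  simp only [Function.comp]
  set x := fdist γ ζ ξ₀
  have hx : 0 < x := hζ.2
  rw [EReal.coe_le_coe_iff]
  have hxp : 0 < x ^ p := Real.rpow_pos_of_pos hx p
  have e : (1 + D / x) ^ p = (x + D) ^ p / x ^ p := by
    rw [← Real.div_rpow (by positivity) hx.le]; congr 1; field_simp
  rw [e, ← mul_div_assoc, ← add_div]
  gcongr
  have h1 := h ζ
  have h2 : fdist γ ζ ξ ^ p ≤ (x + D) ^ p :=
    Real.rpow_le_rpow (fdist_nonneg hγ _ _) (fdist_triangle hγ _ _ _) (by linarith)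
  have := mul_le_mul_of_nonneg_left h2 ht
  linarith

/-! ### Weak and strong duality. -/

section Duality

variable {E : Type*} [NormedAddCommGroup E] {X : Set E} {Y : Set ℝ}
  [SecondCountableTopology E] [MeasurableSpace E] [BorelSpace E]

omit [SecondCountableTopology E] in
lemma measurable_eMoreau {γ p : ℝ} (hp : 1 ≤ p) (f : DataSpace X Y → ℝ) (t : ℝ) :
    Measurable (eMoreau γ p f t : DataSpace X Y → ℝ≥0∞) := by
  refine LowerSemicontinuous.measurable (lowerSemicontinuous_iSup fun ζ => ?_)
  refine Continuous.lowerSemicontinuous ?_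
  have h1 : Continuous fun ξ : DataSpace X Y => fdist γ ζ ξ :=
    (continuous_fdist γ).comp (by fun_prop : Continuous fun ξ : DataSpace X Y => (ζ, ξ))
  have h2 := h1.rpow_const (p := p) fun _ => Or.inr (by linarith)
  exact ENNReal.continuous_ofReal.comp (by fun_prop)

lemma measurable_cost {γ p : ℝ} (hp : 1 ≤ p) :
    Measurable fun z : DataSpace X Y × DataSpace X Y => ENNReal.ofReal (fdist γ z.1 z.2 ^ p) :=
  (ENNReal.continuous_ofReal.comp
    ((continuous_fdist γ).rpow_const fun _ => Or.inr (by linarith))).measurable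

lemma lintegral_weightedEmpirical {n : ℕ} (ξ : Fin n → DataSpace X Y) (w : Fin n → ℝ)
    (g : DataSpace X Y → ℝ≥0∞) :
    ∫⁻ ζ, g ζ ∂(weightedEmpirical ξ w) = ∑ i, ENNReal.ofReal (w i) * g (ξ i) := by
  simp [weightedEmpirical, lintegral_finsetSum_measure, lintegral_smul_measure]

/-- Weak duality. -/
lemma worstCaseRisk_le {γ p σ : ℝ} (hγ : 0 < γ) (hp : 1 ≤ p) (hσ : 0 < σ) {n : ℕ}
    (ξ : Fin n → DataSpace X Y) (w : Fin n → ℝ) {f : DataSpace X Y → ℝ} (hf : Continuous f)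
    {t : ℝ} (ht : 0 ≤ t) :
    worstCaseRisk γ p σ (weightedEmpirical ξ w) f
      ≤ ENNReal.ofReal (t * σ ^ p) + eDualSum γ p ξ w f t := by
  have hp0 : 0 < p := by linarith
  refine iSup₂_le fun Q hQ => ?_
  have hW : (⨅ π ∈ couplings (weightedEmpirical ξ w) Q,
      ∫⁻ z, ENNReal.ofReal (fdist γ z.1 z.2 ^ p) ∂π) ≤ ENNReal.ofReal (σ ^ p) := by
    have := ENNReal.rpow_le_rpow hQ.2 hp0.le
    rwa [wasserstein, ← ENNReal.rpow_mul, one_div_mul_cancel hp0.ne', ENNReal.rpow_one,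
      ENNReal.ofReal_rpow_of_nonneg hσ.le hp0.le] at this
  have hπ : ∀ π ∈ couplings (weightedEmpirical ξ w) Q, ∫⁻ ζ, ENNReal.ofReal (f ζ) ∂Q
      ≤ ENNReal.ofReal t * (∫⁻ z, ENNReal.ofReal (fdist γ z.1 z.2 ^ p) ∂π)
        + eDualSum γ p ξ w f t := by
    rintro π ⟨h1, h2⟩
    rw [eDualSum, ← lintegral_weightedEmpirical, ← h1, ← h2,
      lintegral_map (by fun_prop) measurable_snd,
      lintegral_map (measurable_eMoreau hp f t) measurable_fst,
      ← lintegral_const_mul _ (measurable_cost hp),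
      ← lintegral_add_left ((measurable_cost hp).const_mul _)]
    refine lintegral_mono fun z => ?_
    have hd : 0 ≤ fdist γ z.1 z.2 ^ p := Real.rpow_nonneg (fdist_nonneg hγ _ _) _
    calc ENNReal.ofReal (f z.2)
        = ENNReal.ofReal (t * fdist γ z.1 z.2 ^ p + (f z.2 - t * fdist γ z.2 z.1 ^ p)) := by
          rw [fdist_comm γ z.2 z.1]; congr 1; ring
      _ ≤ ENNReal.ofReal (t * fdist γ z.1 z.2 ^ p)
          + ENNReal.ofReal (f z.2 - t * fdist γ z.2 z.1 ^ p) := ENNReal.ofReal_add_le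
      _ ≤ _ := by
          rw [ENNReal.ofReal_mul ht]
          gcongr
          exact le_iSup (fun ζ => ENNReal.ofReal (f ζ - t * fdist γ ζ z.1 ^ p)) z.2
  rw [ENNReal.ofReal_mul ht]
  refine le_trans ?_ (add_le_add_left (mul_le_mul_right hW _) _)
  -- If t = 0, moving t inside the infimum requires a coupling to exist, since the empty infimum is
  -- ∞ and 0 * ∞ = 0.
  obtain ⟨π₀, hπ₀, -⟩ : ∃ π, ∃ _ : π ∈ couplings (weightedEmpirical ξ w) Q,
      ∫⁻ z, ENNReal.ofReal (fdist γ z.1 z.2 ^ p) ∂π < ⊤ := by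
    simpa only [iInf_lt_iff] using hW.trans_lt ENNReal.ofReal_lt_top
  have : Nonempty (couplings (weightedEmpirical ξ w) Q) := ⟨⟨π₀, hπ₀⟩⟩
  rw [iInf_subtype', ← tsub_le_iff_right, ENNReal.mul_iInf' (by simp) (fun _ => this)]
  exact le_iInf fun π => tsub_le_iff_right.2 (hπ π π.2)

omit [SecondCountableTopology E] [MeasurableSpace E] [BorelSpace E] in
lemma eMoreau_le_of_growth {γ p : ℝ} (hγ : 0 < γ) (hp : 1 ≤ p) {f : DataSpace X Y → ℝ}
    {n : ℕ} (ξ : Fin n → DataSpace X Y) (ξ₀ : DataSpace X Y) {c : ℝ} (hc : 0 < c)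
    (hfc : ∀ ζ, f ζ ≤ c * (1 + fdist γ ζ ξ₀ ^ p)) (i : Fin n) :
    eMoreau γ p f (c * 2 ^ (p - 1)) (ξ i)
      ≤ ENNReal.ofReal (c * (1 + 2 ^ (p - 1) * dataRadius γ ξ ξ₀ ^ p)) := by
  refine iSup_le fun ζ => ENNReal.ofReal_le_ofReal ?_
  have h1 : fdist γ ζ ξ₀ ^ p ≤ 2 ^ (p - 1) * (fdist γ ζ (ξ i) ^ p + fdist γ (ξ i) ξ₀ ^ p) :=
    (Real.rpow_le_rpow (fdist_nonneg hγ _ _) (fdist_triangle hγ _ _ _) (by linarith)).trans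
      (add_rpow_le hp (fdist_nonneg hγ _ _) (fdist_nonneg hγ _ _))
  have h2 : fdist γ (ξ i) ξ₀ ^ p ≤ dataRadius γ ξ ξ₀ ^ p :=
    Real.rpow_le_rpow (fdist_nonneg hγ _ _) (fdist_le_dataRadius ξ ξ₀ i) (by linarith)
  have h3 := mul_le_mul_of_nonneg_left h2 (by positivity : (0 : ℝ) ≤ 2 ^ (p - 1))
  have h4 : fdist γ ζ ξ₀ ^ p
      ≤ 2 ^ (p - 1) * fdist γ ζ (ξ i) ^ p + 2 ^ (p - 1) * dataRadius γ ξ ξ₀ ^ p := by linarith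
  have h5 := mul_le_mul_of_nonneg_left h4 hc.le
  linarith [hfc ζ]

/-- This is weak duality at t = c * 2 ^ (p - 1), where the growth condition makes every h_i finite;
τ is the resulting bound divided by σ ^ p. -/
lemma worstCaseRisk_le_multiplierBound {γ p σ : ℝ} (hγ : 0 < γ) (hp : 1 ≤ p) (hσ : 0 < σ) {n : ℕ}
    (ξ : Fin n → DataSpace X Y) {w : Fin n → ℝ} (hw : ∀ i, 0 ≤ w i) (hw1 : ∑ i, w i = 1)
    {f : DataSpace X Y → ℝ} (hf : Continuous f) (ξ₀ : DataSpace X Y) {c : ℝ} (hc : 0 < c)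
    (hfc : ∀ ζ, f ζ ≤ c * (1 + fdist γ ζ ξ₀ ^ p)) :
    worstCaseRisk γ p σ (weightedEmpirical ξ w) f
      ≤ ENNReal.ofReal (multiplierBound γ p σ ξ ξ₀ c * σ ^ p) := by
  have hσp : 0 < σ ^ p := Real.rpow_pos_of_pos hσ p
  have hρ : 0 ≤ dataRadius γ ξ ξ₀ := Real.iSup_nonneg fun i => fdist_nonneg hγ _ _
  refine (worstCaseRisk_le hγ hp hσ ξ w hf (t := c * 2 ^ (p - 1)) (by positivity)).trans ?_
  have h : eDualSum γ p ξ w f (c * 2 ^ (p - 1))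
      ≤ ENNReal.ofReal (c * (1 + 2 ^ (p - 1) * dataRadius γ ξ ξ₀ ^ p)) := by
    refine (Finset.sum_le_sum fun i _ => mul_le_mul_right
      (eMoreau_le_of_growth hγ hp ξ ξ₀ hc hfc i) _).trans ?_
    rw [← Finset.sum_mul, ← ENNReal.ofReal_sum_of_nonneg fun i _ => hw i, hw1]
    simp
  refine (add_le_add_right h _).trans ?_
  rw [← ENNReal.ofReal_add (by positivity) (by positivity)]
  refine ENNReal.ofReal_le_ofReal (le_of_eq ?_)
  unfold multiplierBound
  field_simp

/-- Mixtures of two transports of the samples `ξ` lie in the Wasserstein ball if their average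
transport cost does not exceed `σ ^ p`. -/
lemma le_worstCaseRisk {γ p σ : ℝ} (hγ : 0 < γ) (hp : 1 ≤ p) (hσ : 0 < σ) {n : ℕ}
    (ξ : Fin n → DataSpace X Y) {w : Fin n → ℝ} (hw : ∀ i, 0 ≤ w i) (hw1 : ∑ i, w i = 1)
    {f : DataSpace X Y → ℝ} (hf : ∀ ζ, 0 ≤ f ζ) (ζ₁ ζ₂ : Fin n → DataSpace X Y) {t : ℝ}
    (ht0 : 0 ≤ t) (ht1 : t ≤ 1)
    (h : (1 - t) * ∑ i, w i * fdist γ (ζ₁ i) (ξ i) ^ p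
      + t * ∑ i, w i * fdist γ (ζ₂ i) (ξ i) ^ p ≤ σ ^ p) :
    ENNReal.ofReal ((1 - t) * ∑ i, w i * f (ζ₁ i) + t * ∑ i, w i * f (ζ₂ i))
      ≤ worstCaseRisk γ p σ (weightedEmpirical ξ w) f := by
  have hp0 : 0 < p := by linarith
  have ht' : 0 ≤ 1 - t := by linarith
  have hsum : ∑ i, ENNReal.ofReal (w i) = 1 := by
    rw [← ENNReal.ofReal_sum_of_nonneg fun i _ => hw i, hw1, ENNReal.ofReal_one]
  have hmix : ENNReal.ofReal (1 - t) + ENNReal.ofReal t = 1 := by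
    rw [← ENNReal.ofReal_add ht' ht0]; simp
  have hreal : ∀ (u : Fin n → ℝ), (∀ i, 0 ≤ u i) → ∀ (v : Fin n → ℝ), (∀ i, 0 ≤ v i) →
      ENNReal.ofReal (1 - t) * ∑ i, ENNReal.ofReal (w i) * ENNReal.ofReal (u i)
        + ENNReal.ofReal t * ∑ i, ENNReal.ofReal (w i) * ENNReal.ofReal (v i)
      = ENNReal.ofReal ((1 - t) * ∑ i, w i * u i + t * ∑ i, w i * v i) := by
    intro u hu v hv
    have hU := Finset.sum_nonneg fun i (_ : i ∈ Finset.univ) => mul_nonneg (hw i) (hu i)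
    have hV := Finset.sum_nonneg fun i (_ : i ∈ Finset.univ) => mul_nonneg (hw i) (hv i)
    rw [ENNReal.ofReal_add (mul_nonneg ht' hU) (mul_nonneg ht0 hV), ENNReal.ofReal_mul ht',
      ENNReal.ofReal_mul ht0,
      ENNReal.ofReal_sum_of_nonneg fun i _ => mul_nonneg (hw i) (hu i),
      ENNReal.ofReal_sum_of_nonneg fun i _ => mul_nonneg (hw i) (hv i)]
    simp only [ENNReal.ofReal_mul (hw _)]
  let Q : Measure (DataSpace X Y) := ENNReal.ofReal (1 - t) • weightedEmpirical ζ₁ w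
    + ENNReal.ofReal t • weightedEmpirical ζ₂ w
  -- `κ ζ` is the plan moving the mass at `ξ i` to `ζ i`; the mixture `π` of two such plans couples
  -- the empirical measure with `Q`.
  let κ : (Fin n → DataSpace X Y) → Measure (DataSpace X Y × DataSpace X Y) := fun ζ =>
    ∑ i, ENNReal.ofReal (w i) • Measure.dirac (ξ i, ζ i)
  let π := ENNReal.ofReal (1 - t) • κ ζ₁ + ENNReal.ofReal t • κ ζ₂
  have hκ1 : ∀ ζ, (κ ζ).map Prod.fst = weightedEmpirical ξ w := fun ζ => by
    simp only [κ, weightedEmpirical]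
    rw [Measure.map_finset_sum measurable_fst.aemeasurable]
    simp [Measure.map_smul, Measure.map_dirac' measurable_fst]
  have hκ2 : ∀ ζ, (κ ζ).map Prod.snd = weightedEmpirical ζ w := fun ζ => by
    simp only [κ, weightedEmpirical]
    rw [Measure.map_finset_sum measurable_snd.aemeasurable]
    simp [Measure.map_smul, Measure.map_dirac' measurable_snd]
  have hκc : ∀ ζ, ∫⁻ z, ENNReal.ofReal (fdist γ z.1 z.2 ^ p) ∂(κ ζ)
      = ∑ i, ENNReal.ofReal (w i) * ENNReal.ofReal (fdist γ (ζ i) (ξ i) ^ p) := fun ζ => by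
    simp [κ, lintegral_finsetSum_measure, lintegral_smul_measure, fdist_comm γ (ξ _)]
  have hd : ∀ (ζ : Fin n → DataSpace X Y) i, 0 ≤ fdist γ (ζ i) (ξ i) ^ p := fun ζ i =>
    Real.rpow_nonneg (fdist_nonneg hγ _ _) _
  have hQ : Q ∈ wassersteinBall γ p σ (weightedEmpirical ξ w) := by
    refine ⟨⟨?_⟩, ?_⟩
    · simp [Q, weightedEmpirical, hsum, hmix]
    · have hπ : π ∈ couplings (weightedEmpirical ξ w) Q := by
        constructor
        · simp only [π]
          rw [Measure.map_add _ _ measurable_fst, Measure.map_smul, Measure.map_smul, hκ1, hκ1,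
            ← add_smul, hmix, one_smul]
        · simp only [π]
          rw [Measure.map_add _ _ measurable_snd, Measure.map_smul, Measure.map_smul, hκ2, hκ2]
      have hcost : ∫⁻ z, ENNReal.ofReal (fdist γ z.1 z.2 ^ p) ∂π ≤ ENNReal.ofReal (σ ^ p) := by
        simp only [π, lintegral_add_measure, lintegral_smul_measure, hκc, smul_eq_mul]
        rw [hreal _ (hd ζ₁) _ (hd ζ₂)]
        exact ENNReal.ofReal_le_ofReal h
      have hinf : (⨅ π ∈ couplings (weightedEmpirical ξ w) Q,
          ∫⁻ z, ENNReal.ofReal (fdist γ z.1 z.2 ^ p) ∂π) ≤ ENNReal.ofReal (σ ^ p) :=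
        (iInf₂_le π hπ).trans hcost
      have := ENNReal.rpow_le_rpow hinf (by positivity : 0 ≤ 1 / p)
      rwa [ENNReal.ofReal_rpow_of_nonneg (by positivity) (by positivity), one_div,
        Real.rpow_rpow_inv hσ.le hp0.ne', ← one_div] at this
  refine le_trans (le_of_eq ?_) (le_iSup₂ (f := fun Q _ => ∫⁻ ζ, ENNReal.ofReal (f ζ) ∂Q) Q hQ)
  simp only [Q, lintegral_add_measure, lintegral_smul_measure, lintegral_weightedEmpirical,
    smul_eq_mul]
  rw [hreal _ (fun _ => hf _) _ (fun _ => hf _)]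

/-- Strong duality, with a multiplier in the query region. -/
lemma exists_multiplier {γ p σ : ℝ} (hγ : 0 < γ) (hp : 1 ≤ p) (hσ : 0 < σ) {n : ℕ}
    (ξ : Fin n → DataSpace X Y) {w : Fin n → ℝ} (hw : ∀ i, 0 ≤ w i) (hw1 : ∑ i, w i = 1)
    {f : DataSpace X Y → ℝ} (hf0 : ∀ ζ, 0 ≤ f ζ) (hf : Continuous f) (ξ₀ : DataSpace X Y) {c : ℝ}
    (hc : 0 < c) (hfc : ∀ ζ, f ζ ≤ c * (1 + fdist γ ζ ξ₀ ^ p)) :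
    ∃ t ∈ queryRegion γ p σ ξ ξ₀ f c, ENNReal.ofReal (t * σ ^ p) + eDualSum γ p ξ w f t
      ≤ worstCaseRisk γ p σ (weightedEmpirical ξ w) f := by
  have hσp : 0 < σ ^ p := Real.rpow_pos_of_pos hσ p
  have hρ : 0 ≤ dataRadius γ ξ ξ₀ := Real.iSup_nonneg fun i => fdist_nonneg hγ _ _
  have hτ : 0 ≤ multiplierBound γ p σ ξ ξ₀ c := by unfold multiplierBound; positivity
  set R := worstCaseRisk γ p σ (weightedEmpirical ξ w) f
  have hRτ : R ≤ ENNReal.ofReal (multiplierBound γ p σ ξ ξ₀ c * σ ^ p) :=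
    worstCaseRisk_le_multiplierBound hγ hp hσ ξ hw hw1 hf ξ₀ hc hfc
  have hR : R ≠ ⊤ := ne_top_of_le_ne_top ENNReal.ofReal_ne_top hRτ
  -- The points of the plane are indexed by joint transports ζ of all samples. The identity
  -- transport has cost 0 < σ ^ p, which is the strictly feasible point needed for a finite slope.
  obtain ⟨t, ht, hsup⟩ := exists_supporting_slope (ι := Fin n → DataSpace X Y)
    (c := fun ζ => ∑ i, w i * fdist γ (ζ i) (ξ i) ^ p) (g := fun ζ => ∑ i, w i * f (ζ i))
    (S := σ ^ p) (R := R.toReal) ξ (by simpa [fdist_self_rpow γ hp] using hσp)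
    (fun ζ₁ ζ₂ s hs0 hs1 h => (ENNReal.ofReal_le_iff_le_toReal hR).1
      (le_worstCaseRisk hγ hp hσ ξ hw hw1 hf0 ζ₁ ζ₂ hs0 hs1 h))
  let u : Fin n → DataSpace X Y → ℝ := fun i ζ => f ζ - t * fdist γ ζ (ξ i) ^ p
  have hline : ∀ ζ : Fin n → DataSpace X Y, ∑ i, w i * u i (ζ i) ≤ R.toReal - t * σ ^ p := by
    intro ζ
    have e : ∑ i, w i * u i (ζ i)
        = ∑ i, w i * f (ζ i) - t * ∑ i, w i * fdist γ (ζ i) (ξ i) ^ p := by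
      rw [Finset.mul_sum, ← Finset.sum_sub_distrib]
      exact Finset.sum_congr rfl fun i _ => by simp only [u]; ring
    have := hsup ζ
    rw [e]; linarith
  have hu : ∀ i, 0 ≤ u i (ξ i) := fun i => by
    simp [u, fdist_self_rpow γ hp, hf0]
  have hpoint : ∀ ζ : Fin n → DataSpace X Y,
      ∑ i, ENNReal.ofReal (w i) * ENNReal.ofReal (u i (ζ i))
        ≤ ENNReal.ofReal (R.toReal - t * σ ^ p) := by
    intro ζ
    classical
    -- Leaving a sample in place wherever its gain is negative makes all gains nonnegative, so the
    -- linear bound also controls the sum of positive parts.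
    let ζ' : Fin n → DataSpace X Y := fun i => if 0 ≤ u i (ζ i) then ζ i else ξ i
    have h0 : ∀ i, 0 ≤ u i (ζ' i) := fun i => by
      by_cases h : 0 ≤ u i (ζ i)
      · simp [ζ', h]
      · simpa [ζ', h] using hu i
    have hle : ∀ i, ENNReal.ofReal (u i (ζ i)) ≤ ENNReal.ofReal (u i (ζ' i)) := fun i => by
      by_cases h : 0 ≤ u i (ζ i)
      · simp [ζ', h]
      · rw [ENNReal.ofReal_of_nonpos (not_le.1 h).le]; exact zero_le
    refine le_trans (Finset.sum_le_sum fun i _ => mul_le_mul_right (hle i) _) ?_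
    simp only [← ENNReal.ofReal_mul (hw _)]
    rw [← ENNReal.ofReal_sum_of_nonneg fun i _ => mul_nonneg (hw i) (h0 i)]
    exact ENNReal.ofReal_le_ofReal (hline ζ')
  have hdual : eDualSum γ p ξ w f t ≤ ENNReal.ofReal (R.toReal - t * σ ^ p) := by
    classical
    have e : ∀ i, ENNReal.ofReal (w i) * eMoreau γ p f t (ξ i)
        = ⨆ ζ : Fin n → DataSpace X Y, ENNReal.ofReal (w i) * ENNReal.ofReal (u i (ζ i)) := by
      intro i
      have hs : Function.Surjective fun ζ : Fin n → DataSpace X Y => ζ i :=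
        fun x => ⟨fun _ => x, rfl⟩
      rw [eMoreau, ENNReal.mul_iSup]
      exact (hs.iSup_comp fun x => ENNReal.ofReal (w i) * ENNReal.ofReal (u i x)).symm
    rw [eDualSum, Finset.sum_congr rfl fun i _ => e i, ENNReal.finsetSum_iSup]
    · exact iSup_le hpoint
    -- The sum of suprema is a supremum of sums: choosing the better target separately for each
    -- sample dominates both transports.
    · intro ζ₁ ζ₂
      refine ⟨fun i => if u i (ζ₁ i) ≤ u i (ζ₂ i) then ζ₂ i else ζ₁ i, fun i => ?_⟩
      by_cases h : u i (ζ₁ i) ≤ u i (ζ₂ i)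
      · simp only [h, if_true]
        exact ⟨by gcongr, le_rfl⟩
      · simp only [h, if_false]
        exact ⟨le_rfl, by gcongr; exact (not_le.1 h).le⟩
  have htR : t * σ ^ p ≤ R.toReal := by
    have := (Finset.sum_nonneg fun i (_ : i ∈ Finset.univ) => mul_nonneg (hw i) (hu i)).trans
      (hline ξ)
    linarith
  refine ⟨t, ⟨ht, ?_, ?_⟩, ?_⟩
  -- Lower end κ ≤ t: the finite dual sum forces h_i(t) to be finite at a sample of positive weight.
  · obtain ⟨i, hi⟩ : ∃ i, 0 < w i := by
      by_contra! hneg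
      have := Finset.sum_nonpos fun i (_ : i ∈ Finset.univ) => hneg i
      linarith
    have hfin : eMoreau γ p f t (ξ i) ≠ ⊤ := by
      intro htop
      have h1 : ENNReal.ofReal (w i) * eMoreau γ p f t (ξ i) ≤ eDualSum γ p ξ w f t :=
        Finset.single_le_sum (f := fun i => ENNReal.ofReal (w i) * eMoreau γ p f t (ξ i))
          (fun _ _ => zero_le) (Finset.mem_univ i)
      rw [htop, ENNReal.mul_top (by simpa using hi)] at h1
      exact ENNReal.ofReal_ne_top (top_le_iff.1 (h1.trans hdual))
    refine growthRate_le hγ hp ξ₀ (ξ i) (hf0 _) ht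
      (M := (eMoreau γ p f t (ξ i)).toReal) fun ζ => ?_
    exact (ENNReal.ofReal_le_iff_le_toReal hfin).1
      (le_iSup (fun ζ => ENNReal.ofReal (f ζ - t * fdist γ ζ (ξ i) ^ p)) ζ)
  -- Upper end t ≤ τ: t * σ ^ p ≤ R ≤ τ * σ ^ p, the first because staying in place has nonnegative
  -- gain.
  · have := ENNReal.toReal_le_of_le_ofReal (by positivity) hRτ
    exact le_of_mul_le_mul_right (htR.trans this) hσp
  · refine (add_le_add_right hdual _).trans ?_
    rw [← ENNReal.ofReal_add (by positivity) (by linarith)]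
    simp [ENNReal.ofReal_toReal hR]

end Duality

/-! ### Transfer from dual objectives to risks. -/

section Coreset

variable {E : Type*} [NormedAddCommGroup E] {X : Set E} {Y : Set ℝ}
  [SecondCountableTopology E] [MeasurableSpace E] [BorelSpace E]

/-- If the dual objective for the weights `v` is at least `a ≤ 1` times the one for the weights `w`
on the query region, then the same holds for the worst-case risks. -/
lemma mul_worstCaseRisk_le {γ p σ : ℝ} (hγ : 0 < γ) (hp : 1 ≤ p) (hσ : 0 < σ) {n : ℕ}
    (ξ : Fin n → DataSpace X Y) (w : Fin n → ℝ) {v : Fin n → ℝ} (hv : ∀ i, 0 ≤ v i)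
    (hv1 : ∑ i, v i = 1) {f : DataSpace X Y → ℝ} (hf0 : ∀ ζ, 0 ≤ f ζ) (hf : Continuous f)
    (ξ₀ : DataSpace X Y) {c : ℝ} (hc : 0 < c) (hfc : ∀ ζ, f ζ ≤ c * (1 + fdist γ ζ ξ₀ ^ p))
    {a b : ℝ≥0∞} (hab : a ≤ b)
    (h : ∀ t ∈ queryRegion γ p σ ξ ξ₀ f c, a * eDualSum γ p ξ w f t ≤ b * eDualSum γ p ξ v f t) :
    a * worstCaseRisk γ p σ (weightedEmpirical ξ w) f
      ≤ b * worstCaseRisk γ p σ (weightedEmpirical ξ v) f := by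
  -- The multiplier is optimal for `v`; for `w` only weak duality is used.
  obtain ⟨t, ht, hR⟩ := exists_multiplier hγ hp hσ ξ hv hv1 hf0 hf ξ₀ hc hfc
  calc a * worstCaseRisk γ p σ (weightedEmpirical ξ w) f
      ≤ a * ENNReal.ofReal (t * σ ^ p) + a * eDualSum γ p ξ w f t := by
        rw [← mul_add]; gcongr; exact worstCaseRisk_le hγ hp hσ ξ w hf ht.1
    _ ≤ b * ENNReal.ofReal (t * σ ^ p) + b * eDualSum γ p ξ v f t :=
        add_le_add (by gcongr) (h t ht)
    _ ≤ b * worstCaseRisk γ p σ (weightedEmpirical ξ v) f := by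
        rw [← mul_add]; gcongr

end Coreset

lemma uniformWeights_nonneg (n : ℕ) (i : Fin n) : 0 ≤ uniformWeights n i := by
  unfold uniformWeights; positivity

lemma sum_uniformWeights {n : ℕ} (hn : 0 < n) : ∑ i, uniformWeights n i = 1 := by
  have : (n : ℝ) ≠ 0 := by positivity
  simp [uniformWeights, this]

lemma ofReal_mul_le_of_coe {a b : ℝ} (ha : 0 ≤ a) (hb : 0 ≤ b) {x y : ℝ≥0∞}
    (h : (a : EReal) * x ≤ (b : EReal) * y) : ENNReal.ofReal a * x ≤ ENNReal.ofReal b * y := by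
  rw [← EReal.coe_ennreal_le_coe_ennreal_iff, EReal.coe_ennreal_mul, EReal.coe_ennreal_mul,
    EReal.coe_ennreal_ofReal, EReal.coe_ennreal_ofReal, max_eq_left ha, max_eq_left hb]
  exact h

end WDRO

end

theorem mainTheorem3
    -- the data space: features in `ℝ^m` with an arbitrary norm, real labels
    {E : Type*} [NormedAddCommGroup E] [NormedSpace ℝ E] [FiniteDimensional ℝ E]
    [MeasurableSpace E] [BorelSpace E]
    (X : Set E) (Y : Set ℝ)
    -- the metric `fdist γ` is bi-Lipschitz equivalent to the product metric used here
    [CompleteSpace (WDRO.DataSpace X Y)]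
    (γ p σ : ℝ) (hγ : 0 < γ) (hp : 1 ≤ p) (hσ : 0 < σ)
    -- the data samples
    (n : ℕ) (hn : 0 < n) (ξ : Fin n → WDRO.DataSpace X Y)
    -- the feasible region and the nonnegative loss
    (k : ℕ) (Θ : Set (EuclideanSpace ℝ (Fin k)))
    (ℓ : EuclideanSpace ℝ (Fin k) → WDRO.DataSpace X Y → ℝ)
    (hℓ_nonneg : ∀ θ ∈ Θ, ∀ ζ, 0 ≤ ℓ θ ζ)
    -- boundedness and Lipschitz smoothness in the parameter
    (θanc : EuclideanSpace ℝ (Fin k)) (lp : ℝ) (hlp : 0 < lp)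
    (hΘ : Θ ⊆ Metric.closedBall θanc lp)
    (L : ℝ) (hL : 0 < L)
    (hLip : ∀ ζ, ∀ θ₁ ∈ Metric.closedBall θanc lp, ∀ θ₂ ∈ Metric.closedBall θanc lp,
      |ℓ θ₁ ζ - ℓ θ₂ ζ| ≤ L * ‖θ₁ - θ₂‖)
    -- continuity and bounded growth rate in the data
    (hcont : ∀ θ ∈ Θ, Continuous (ℓ θ))
    (C : EuclideanSpace ℝ (Fin k) → ℝ) (hC_pos : ∀ θ ∈ Θ, 0 < C θ) (hC_cont : ContinuousOn C Θ)
    (ξ₀ : WDRO.DataSpace X Y)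
    (hgrowth : ∀ θ ∈ Θ, ∀ ζ, ℓ θ ζ ≤ C θ * (1 + WDRO.fdist γ ζ ξ₀ ^ p))
    -- a dual coreset and an approximate minimizer of the worst-case risk on it
    (ε : ℝ) (hε0 : 0 < ε) (hε1 : ε < 1)
    (w : Fin n → ℝ) (hw : WDRO.IsDualCoreset γ p σ Θ ℓ ξ ξ₀ C ε w)
    (α : ℝ) (hα : 1 ≤ α) (θ₀ : EuclideanSpace ℝ (Fin k))
    (hθ₀ : WDRO.IsApproxMinimizer
      (fun θ => WDRO.worstCaseRisk γ p σ (WDRO.weightedEmpirical ξ w) (ℓ θ)) Θ α θ₀) :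
    WDRO.IsApproxMinimizer
      (fun θ => WDRO.worstCaseRisk γ p σ
        (WDRO.weightedEmpirical ξ (WDRO.uniformWeights n)) (ℓ θ))
      Θ (α * ((1 + ε) / (1 - ε))) θ₀ := by
  have hn1 := WDRO.sum_uniformWeights hn
  have hn0 := WDRO.uniformWeights_nonneg n
  have : ProperSpace E := FiniteDimensional.proper_real E
  have hε : 0 < 1 - ε := by linarith
  have lower : ∀ θ ∈ Θ, ENNReal.ofReal (1 - ε)
      * WDRO.worstCaseRisk γ p σ (WDRO.weightedEmpirical ξ (WDRO.uniformWeights n)) (ℓ θ)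
      ≤ WDRO.worstCaseRisk γ p σ (WDRO.weightedEmpirical ξ w) (ℓ θ) := fun θ hθ => by
    have := WDRO.mul_worstCaseRisk_le hγ hp hσ ξ (WDRO.uniformWeights n) hw.nonneg hw.sum_eq_one
      (hℓ_nonneg θ hθ) (hcont θ hθ) ξ₀ (hC_pos θ hθ) (hgrowth θ hθ)
      (ENNReal.ofReal_le_ofReal (by linarith : 1 - ε ≤ 1)) fun t ht =>
        WDRO.ofReal_mul_le_of_coe hε.le zero_le_one (by
          rw [WDRO.coe_eDualSum hp (hℓ_nonneg θ hθ) t ξ hn0,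
            WDRO.coe_eDualSum hp (hℓ_nonneg θ hθ) t ξ hw.nonneg]
          simpa using hw.lower θ hθ t ht)
    simpa using this
  have upper : ∀ θ ∈ Θ, WDRO.worstCaseRisk γ p σ (WDRO.weightedEmpirical ξ w) (ℓ θ)
      ≤ ENNReal.ofReal (1 + ε)
      * WDRO.worstCaseRisk γ p σ (WDRO.weightedEmpirical ξ (WDRO.uniformWeights n)) (ℓ θ) :=
    fun θ hθ => by
    have := WDRO.mul_worstCaseRisk_le hγ hp hσ ξ w hn0 hn1
      (hℓ_nonneg θ hθ) (hcont θ hθ) ξ₀ (hC_pos θ hθ) (hgrowth θ hθ)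
      (ENNReal.ofReal_le_ofReal (by linarith : 1 ≤ 1 + ε)) fun t ht =>
        WDRO.ofReal_mul_le_of_coe zero_le_one (by linarith) (by
          rw [WDRO.coe_eDualSum hp (hℓ_nonneg θ hθ) t ξ hn0,
            WDRO.coe_eDualSum hp (hℓ_nonneg θ hθ) t ξ hw.nonneg]
          simpa using hw.upper θ hθ t ht)
    simpa using this
  have hfac : 0 < α * ((1 + ε) / (1 - ε)) := by positivity
  refine ⟨hθ₀.1, ?_⟩
  simp only [ENNReal.mul_iInf_of_ne (ENNReal.ofReal_pos.2 hfac).ne' ENNReal.ofReal_ne_top]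
  refine le_iInf₂ fun θ hθ => ?_
  -- With R_n and R_w the original and coreset risks: (1 - ε) R_n(θ₀) ≤ R_w(θ₀) ≤ α R_w(θ) ≤ α (1 +
  -- ε) R_n(θ).
  have h1 := (lower θ₀ hθ₀.1).trans (hθ₀.2.trans (mul_le_mul_right
    ((iInf₂_le θ hθ).trans (upper θ hθ)) (ENNReal.ofReal α)))
  have h2 := mul_le_mul_right h1 (ENNReal.ofReal (1 - ε)⁻¹)
  rw [← mul_assoc, ← mul_assoc, ← mul_assoc, ← ENNReal.ofReal_mul (by positivity),
    ← ENNReal.ofReal_mul (by positivity), ← ENNReal.ofReal_mul (by positivity),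
    inv_mul_cancel₀ hε.ne', ENNReal.ofReal_one, one_mul] at h2
  rwa [show α * ((1 + ε) / (1 - ε)) = (1 - ε)⁻¹ * α * (1 + ε) by ring]
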